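/- Let $n\ge 0$ be an integer. A permutation $a_1a_2\ldots a_m$ of $\{1,\ldots,m\}$ is \emph{312-avoiding} if there are no $i<j<k$ with $a_j<a_k<a_i$. Its \emph{up/down pattern} is the word $x_1x_2\ldots x_{m-1}$ with $x_i=D$ if $a_i>a_{i+1}$ and $x_i=U$ if $a_i<a_{i+1}$. A permutation of $\{1,\ldots,2n\}$ is called \emph{alternating} if its up/down pattern is $DUDU\ldots DUD$ (of length $2n-1$; for $n=0$ the empty permutation is alternating). A \emph{triangulation} of a convex polygon with labelled vertices is a dissection of it into triangles by pairwise non-crossing diagonals, i.e. a maximal set of pairwise non-crossing diagonals (the degenerate $2$-gon has exactly one triangulation, the empty set). Then the alternating 312-avoiding permutations of $\{1,\ldots,2n\}$ are in bijection with the triangulations of a convex $(n+2)$-gon, and hence also in bijection with the 312-avoiding permutations of $\{1,\ldots,n\}$. -/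

import Mathlib

namespace PermPolygon

/-- A permutation of `m` letters (in one-line notation `π 0, π 1, …, π (m-1)`, with positions and
values numbered from `0`) is 312-avoiding if there are no positions `i < j < k` with
`π j < π k < π i`. -/
def Avoids312 {m : ℕ} (π : Equiv.Perm (Fin m)) : Prop :=
  ∀ i j k : Fin m, i < j → j < k → ¬ (π j < π k ∧ π k < π i)

/-- The letters of an up/down pattern. -/
inductive UpDown : Type
  | U
  | D

/-- The up/down pattern of a permutation of `m` letters: the word of length `m - 1` whose letter at
position `i` is `D` if `π i > π (i + 1)`, and `U` otherwise, that is, if `π i < π (i + 1)`. -/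
def upDownPattern {m : ℕ} (π : Equiv.Perm (Fin m)) : Fin (m - 1) → UpDown :=
  fun i => if π ⟨i.val + 1, by omega⟩ < π ⟨i.val, by omega⟩ then UpDown.D else UpDown.U

/-- The word `DUDU…` of a given length, beginning with `D`. For length `2 * n - 1` with `1 ≤ n` it
is `DUDU…DUD`. -/
def alternatingWord (l : ℕ) : Fin l → UpDown :=
  fun i => if i.val % 2 = 0 then UpDown.D else UpDown.U

/-- A permutation is alternating if its up/down pattern is `DUDU…`. -/
def IsAlternating {m : ℕ} (π : Equiv.Perm (Fin m)) : Prop :=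
  upDownPattern π = alternatingWord (m - 1)

/-- The vertices of a convex `m`-gon are labelled `0, 1, …, m - 1` in cyclic order. The pair
`(i, j)`, written with `i < j`, is a diagonal if `i` and `j` are not neighbours on the boundary. -/
def IsDiagonal {m : ℕ} (d : Fin m × Fin m) : Prop :=
  d.1.val + 1 < d.2.val ∧ ¬ (d.1.val = 0 ∧ d.2.val + 1 = m)

/-- Two diagonals (each written with its smaller endpoint first) of a convex polygon cross, that is,
meet in an interior point of both, if their endpoints strictly interlace. -/
def Crosses {m : ℕ} (d e : Fin m × Fin m) : Prop :=
  (d.1 < e.1 ∧ e.1 < d.2 ∧ d.2 < e.2) ∨ (e.1 < d.1 ∧ d.1 < e.2 ∧ e.2 < d.2)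

/-- A dissection of a convex `m`-gon, given by its set of pairwise non-crossing diagonals. -/
def IsDissection {m : ℕ} (T : Finset (Fin m × Fin m)) : Prop :=
  (∀ d ∈ T, IsDiagonal d) ∧ ∀ d ∈ T, ∀ e ∈ T, ¬ Crosses d e

/-- A triangulation of a convex `m`-gon: a dissection by a maximal set of non-crossing diagonals
(equivalently, all pieces are triangles). -/
def IsTriangulation {m : ℕ} (T : Finset (Fin m × Fin m)) : Prop :=
  Maximal IsDissection T

end PermPolygon

namespace PermPolygon

/-! All three families are counted by the Catalan number `catalan n`, each by the recursion
`catalan_succ`; the bijections then come from equality of finite cardinalities and are not explicit.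

A 312-avoiding word is cut at its least letter `c` into `L c R`. A letter of `L` above a letter of
`R` would form 312 with `c` in the middle, so `L` and `R` fill consecutive intervals and are
otherwise free (`mem_avoidingWords_succ`). In an alternating word the least letter is a valley,
which forces `L` to have odd length, and the pattern restarts on `R`
(`mem_alternatingWords_add_two`); this gives the same recursion in half the length.

A triangulation is cut along the triangle on the base `(a, b)`: its apex `c` leaves arbitrary
triangulations of the polygons on `a, …, c` and on `c, …, b` (`exists_apex`, `eq_glue`, `glue_mem`).
Words and chords live over `ℕ` with a variable starting label, so that the parts of an object have
the same type as the whole. -/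

/-! ### Counting a disjoint union of products -/

theorem exists_finset_of_encard_eq {α : Type*} {X : Set α} {n : ℕ} (h : X.encard = n) :
    ∃ F : Finset α, (∀ x, x ∈ F ↔ x ∈ X) ∧ F.card = n := by
  have hf : X.Finite := Set.finite_of_encard_eq_coe h
  refine ⟨hf.toFinset, by simp, ?_⟩
  rw [hf.encard_eq_coe_toFinset_card] at h
  exact_mod_cast h

/-- The common form of the three Catalan recursions: `k` records where an object is cut, `f k`
reassembles it, and `inj` says that the cut and both parts can be recovered. -/
theorem encard_of_eq_biUnion_image2 {ι α β γ : Type*} {S : Set γ} (s : Finset ι)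
    (f : ι → α → β → γ) (A : ι → Set α) (B : ι → Set β) (a b : ι → ℕ)
    (hA : ∀ k ∈ s, (A k).encard = a k) (hB : ∀ k ∈ s, (B k).encard = b k)
    (hS : ∀ z, z ∈ S ↔ ∃ k ∈ s, ∃ x ∈ A k, ∃ y ∈ B k, f k x y = z)
    (inj : ∀ k ∈ s, ∀ k' ∈ s, ∀ x ∈ A k, ∀ x' ∈ A k', ∀ y ∈ B k, ∀ y' ∈ B k',
      f k x y = f k' x' y' → k = k' ∧ x = x' ∧ y = y') :
    S.encard = (∑ k ∈ s, a k * b k : ℕ) := by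
  classical
  -- Stated for every `k`, with `∅` as a dummy value off `s`, so that `choose` yields a total
  -- function.
  have hA' : ∀ k, ∃ F : Finset α, k ∈ s → (∀ x, x ∈ F ↔ x ∈ A k) ∧ F.card = a k := by
    intro k
    by_cases hk : k ∈ s
    · obtain ⟨F, hF⟩ := exists_finset_of_encard_eq (hA k hk)
      exact ⟨F, fun _ => hF⟩
    · exact ⟨∅, fun h => absurd h hk⟩
  have hB' : ∀ k, ∃ F : Finset β, k ∈ s → (∀ x, x ∈ F ↔ x ∈ B k) ∧ F.card = b k := by
    intro k
    by_cases hk : k ∈ s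
    · obtain ⟨F, hF⟩ := exists_finset_of_encard_eq (hB k hk)
      exact ⟨F, fun _ => hF⟩
    · exact ⟨∅, fun h => absurd h hk⟩
  choose FA hFA using hA'
  choose FB hFB using hB'
  let G : Finset (Σ _ : ι, α × β) := s.sigma fun k => FA k ×ˢ FB k
  have hG : S = ((G.image fun p => f p.1 p.2.1 p.2.2 : Finset γ) : Set γ) := by
    ext z
    rw [hS]
    simp only [Finset.coe_image, Set.mem_image, Finset.mem_coe, G, Finset.mem_sigma,
      Finset.mem_product]
    constructor
    · rintro ⟨k, hk, x, hx, y, hy, rfl⟩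
      exact ⟨⟨k, x, y⟩, ⟨hk, ((hFA k hk).1 x).2 hx, ((hFB k hk).1 y).2 hy⟩, rfl⟩
    · rintro ⟨⟨k, x, y⟩, ⟨hk, hx, hy⟩, rfl⟩
      exact ⟨k, hk, x, ((hFA k hk).1 x).1 hx, y, ((hFB k hk).1 y).1 hy, rfl⟩
  rw [hG, Set.encard_coe_eq_coe_finsetCard, Finset.card_image_of_injOn, Finset.card_sigma]
  · congr 1
    refine Finset.sum_congr rfl fun k hk => ?_
    rw [Finset.card_product, (hFA k hk).2, (hFB k hk).2]
  · rintro ⟨k, x, y⟩ h ⟨k', x', y'⟩ h' e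
    simp only [G, Finset.mem_coe, Finset.mem_sigma, Finset.mem_product] at h h'
    obtain ⟨rfl, rfl, rfl⟩ := inj k h.1 k' h'.1 x (((hFA k h.1).1 x).1 h.2.1)
      x' (((hFA k' h'.1).1 x').1 h'.2.1) y (((hFB k h.1).1 y).1 h.2.2)
      y' (((hFB k' h'.1).1 y').1 h'.2.2) e
    rfl

/-! ### 312-avoiding words -/

/-- A word over `ℕ` is 312-avoiding if no subword of three letters has pattern 312. -/
def ListAvoids (l : List ℕ) : Prop :=
  ∀ x y z, [x, y, z].Sublist l → ¬ (y < z ∧ z < x)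

/-- The descents of the word are exactly at the even positions. -/
def ListAlternating (l : List ℕ) : Prop :=
  ∀ i (h : i + 1 < l.length), l[i + 1] < l[i] ↔ i % 2 = 0

/-- The 312-avoiding arrangements of `c, c + 1, …, c + m - 1`. -/
def avoidingWords (c m : ℕ) : Set (List ℕ) :=
  {l | l.Nodup ∧ (∀ x, x ∈ l ↔ c ≤ x ∧ x < c + m) ∧ ListAvoids l}

theorem toFinset_of_mem_avoidingWords {c m : ℕ} {l : List ℕ} (h : l ∈ avoidingWords c m) :
    l.toFinset = Finset.Ico c (c + m) := by
  ext x; simp [h.2.1]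

theorem length_of_mem_avoidingWords {c m : ℕ} {l : List ℕ} (h : l ∈ avoidingWords c m) :
    l.length = m := by
  rw [← List.toFinset_card_of_nodup h.1, toFinset_of_mem_avoidingWords h]
  simp

/-- No label below an element of `A` can lie in `B`, so `A` is closed downwards in the interval, and
its cardinality fixes it. -/
theorem eq_Ico_of_lt {A B : Finset ℕ} {a m : ℕ} (hlt : ∀ x ∈ A, ∀ y ∈ B, x < y)
    (hU : ∀ x, x ∈ A ∨ x ∈ B ↔ a ≤ x ∧ x < a + m) : A = Finset.Ico a (a + A.card) := by
  refine Finset.eq_of_subset_of_card_le ?_ (by simp)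
  intro x hx
  have hxr := (hU x).1 (Or.inl hx)
  have hsub : Finset.Ico a (x + 1) ⊆ A := by
    intro y hy
    rw [Finset.mem_Ico] at hy
    rcases (hU y).2 ⟨hy.1, by omega⟩ with h | h
    · exact h
    · have := hlt x hx y h
      omega
  have := Finset.card_le_card hsub
  rw [Nat.card_Ico] at this
  rw [Finset.mem_Ico]
  omega

/-- The least letter can only play the 1 of a 312. Conversely, once `L` lies below `R`, a 312 cannot
straddle the cut, since its 3 would be in `L` and its last letter would be `c` or in `R`. -/
theorem listAvoids_split {c : ℕ} {L R : List ℕ} (hL : ∀ x ∈ L, c < x) (hR : ∀ x ∈ R, c < x)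
    (hne : ∀ x ∈ L, x ∉ R) :
    ListAvoids (L ++ c :: R) ↔ ListAvoids L ∧ ListAvoids R ∧ ∀ x ∈ L, ∀ y ∈ R, x < y := by
  constructor
  · intro h
    refine ⟨fun x y z hs => h x y z (hs.trans (List.sublist_append_left _ _)),
      fun x y z hs => h x y z (hs.trans ((List.sublist_cons_self _ _).trans
        (List.sublist_append_right _ _))), ?_⟩
    intro x hx y hy
    have h1 : [x, c, y].Sublist (L ++ c :: R) :=
      (List.singleton_sublist.2 hx).append ((List.singleton_sublist.2 hy).cons_cons c)
    have h2 := h _ _ _ h1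
    have h3 := hR y hy
    have h4 : x ≠ y := fun e => hne x hx (e ▸ hy)
    omega
  · rintro ⟨h1, h2, h3⟩ x y z hs ⟨hyz, hzx⟩
    obtain ⟨l₁, l₂, he, hs1, hs2⟩ := List.sublist_append_iff.1 hs
    have hm : ∀ w ∈ l₂, w = c ∨ w ∈ R := fun w hw => by simpa using hs2.subset hw
    have hml : ∀ w ∈ l₁, w ∈ L := fun w hw => hs1.subset hw
    -- Cases on how many of the three letters fall in `L`.
    match l₁, he with
    | [], he =>
      simp only [List.nil_append] at he
      subst he
      rcases List.cons_sublist_cons'.1 hs2 with h | h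
      · exact h2 x y z h ⟨hyz, hzx⟩
      · obtain ⟨rfl, h⟩ := h
        have := hR z (h.subset (by simp))
        omega
    | [_], he =>
      simp only [List.cons_append, List.nil_append, List.cons.injEq] at he
      obtain ⟨rfl, rfl⟩ := he
      have hx := hml x (by simp)
      rcases hm z (by simp) with rfl | hz
      · rcases hm y (by simp) with rfl | hy
        · omega
        · have := hR y hy
          omega
      · have := h3 x hx z hz
        omega
    | [_, _], he =>
      simp only [List.cons_append, List.nil_append, List.cons.injEq] at he
      obtain ⟨rfl, rfl, rfl⟩ := he
      have hx := hml x (by simp)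
      have hy := hml y (by simp)
      rcases hm z (by simp) with rfl | hz
      · have := hL y hy
        omega
      · have := h3 x hx z hz
        omega
    | _ :: _ :: _ :: t, he =>
      simp only [List.cons_append, List.cons.injEq, List.nil_eq, List.append_eq_nil_iff] at he
      obtain ⟨rfl, rfl, rfl, rfl, rfl⟩ := he
      exact h1 x y z hs1 ⟨hyz, hzx⟩

theorem mem_avoidingWords_succ {c m : ℕ} {l : List ℕ} :
    l ∈ avoidingWords c (m + 1) ↔ ∃ k ≤ m, ∃ L ∈ avoidingWords (c + 1) k,
      ∃ R ∈ avoidingWords (c + 1 + k) (m - k), L ++ c :: R = l := by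
  constructor
  · rintro ⟨hnd, hmem, hav⟩
    obtain ⟨L, R, rfl⟩ := List.append_of_mem ((hmem c).2 ⟨le_rfl, by omega⟩)
    have hnd' := List.nodup_append.1 hnd
    have hcR := List.nodup_cons.1 hnd'.2.1
    have hcL : c ∉ L := fun h => hnd'.2.2 c h c (by simp) rfl
    have hL : ∀ x ∈ L, c < x := fun x hx => by
      have h1 := (hmem x).1 (by simp [hx])
      have h2 : x ≠ c := fun e => hcL (e ▸ hx)
      omega
    have hR : ∀ x ∈ R, c < x := fun x hx => by
      have h1 := (hmem x).1 (by simp [hx])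
      have h2 : x ≠ c := fun e => hcR.1 (e ▸ hx)
      omega
    have hne : ∀ x ∈ L, x ∉ R := fun x hx hx' => hnd'.2.2 x hx x (by simp [hx']) rfl
    obtain ⟨aL, aR, hlt⟩ := (listAvoids_split hL hR hne).1 hav
    have hU : ∀ x, x ∈ L.toFinset ∨ x ∈ R.toFinset ↔ c + 1 ≤ x ∧ x < c + 1 + m := by
      intro x
      simp only [List.mem_toFinset]
      constructor
      · rintro (h | h)
        · have h1 := (hmem x).1 (by simp [h])
          have h2 := hL x h
          omega
        · have h1 := (hmem x).1 (by simp [h])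
          have h2 := hR x h
          omega
      · intro h
        have h1 := (hmem x).2 (by omega)
        simp only [List.mem_append, List.mem_cons] at h1
        rcases h1 with h1 | h1 | h1
        · exact Or.inl h1
        · omega
        · exact Or.inr h1
    have hI := eq_Ico_of_lt (by simpa using hlt) hU
    rw [List.toFinset_card_of_nodup hnd'.1] at hI
    have hLm : ∀ x, x ∈ L ↔ c + 1 ≤ x ∧ x < c + 1 + L.length := fun x => by
      rw [← List.mem_toFinset, hI, Finset.mem_Ico]
    have hk : L.length ≤ m := by
      by_contra hk
      have := (hU (c + 1 + m)).1 (Or.inl (List.mem_toFinset.2 ((hLm _).2 (by omega))))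
      omega
    refine ⟨L.length, hk, L, ⟨hnd'.1, hLm, aL⟩, R, ⟨hcR.2, fun x => ?_, aR⟩, rfl⟩
    have h1 := hU x
    simp only [List.mem_toFinset] at h1
    have h2 := hLm x
    have h3 := hne x
    constructor
    · intro h
      have := h1.1 (Or.inr h)
      have : x ∉ L := fun h' => h3 h' h
      rw [h2] at this
      omega
    · intro h
      rcases h1.2 (by omega) with h' | h'
      · have := h2.1 h'
        omega
      · exact h'
  · rintro ⟨k, hk, L, ⟨hLn, hLm, hLa⟩, R, ⟨hRn, hRm, hRa⟩, rfl⟩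
    have hL : ∀ x ∈ L, c < x := fun x hx => by have := (hLm x).1 hx; omega
    have hR : ∀ x ∈ R, c < x := fun x hx => by have := (hRm x).1 hx; omega
    have hlt : ∀ x ∈ L, ∀ y ∈ R, x < y := fun x hx y hy => by
      have := (hLm x).1 hx
      have := (hRm y).1 hy
      omega
    refine ⟨?_, fun x => ?_, (listAvoids_split hL hR fun x hx hx' =>
      lt_irrefl _ (hlt x hx x hx')).2 ⟨hLa, hRa, hlt⟩⟩
    · refine List.nodup_append.2 ⟨hLn, List.nodup_cons.2 ⟨fun h => lt_irrefl _ (hR c h), hRn⟩, ?_⟩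
      rintro x hx y hy rfl
      rcases List.mem_cons.1 hy with rfl | hy
      · exact lt_irrefl _ (hL _ hx)
      · exact lt_irrefl _ (hlt _ hx _ hy)
    · rw [List.mem_append, List.mem_cons, hLm, hRm]
      omega

theorem split_injective {c k k' j : ℕ} {L L' R R' : List ℕ}
    (hL : L ∈ avoidingWords (c + 1) k) (hL' : L' ∈ avoidingWords (c + 1) k')
    (hR : R ∈ avoidingWords (c + 1 + k) j) (h : L ++ c :: R = L' ++ c :: R') : k = k' ∧ L = L' ∧ R = R' := by
  have hcL : c ∉ L := fun hc => by
    have := (hL.2.1 c).1 hc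
    omega
  have hcR : c ∉ R := fun hc => by
    have := (hR.2.1 c).1 hc
    omega
  obtain ⟨h1, -, h2⟩ := (List.append_cons_inj_of_notMem hcL hcR).1 h
  refine ⟨?_, h1, h2⟩
  rw [← length_of_mem_avoidingWords hL, ← length_of_mem_avoidingWords hL', h1]

theorem avoidingWords_zero (c : ℕ) : avoidingWords c 0 = {[]} := by
  ext l
  rw [Set.mem_singleton_iff]
  constructor
  · intro h
    exact List.length_eq_zero_iff.1 (length_of_mem_avoidingWords h)
  · rintro rfl
    refine ⟨by simp, fun x => ?_, fun x y z h => by simp at h⟩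
    simp

theorem encard_avoidingWords (c m : ℕ) : (avoidingWords c m).encard = catalan m := by
  induction m using Nat.strong_induction_on generalizing c with
  | _ m ih =>
    rcases m with _ | m
    · simp [avoidingWords_zero]
    · rw [encard_of_eq_biUnion_image2 (Finset.range (m + 1)) (fun _ L R => L ++ c :: R)
        (fun k => avoidingWords (c + 1) k) (fun k => avoidingWords (c + 1 + k) (m - k))
        (fun k => catalan k) (fun k => catalan (m - k)), catalan_succ, Finset.sum_range]
      · intro k hk
        exact ih k (by simpa using hk) _
      · intro k hk
        exact ih _ (by omega) _
      · intro l
        rw [mem_avoidingWords_succ]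
        simp
      · intro k _ k' _ L hL L' hL' R hR R' _ h
        exact split_injective hL hL' hR h

/-! ### Alternating 312-avoiding words -/

theorem listAlternating_split {c : ℕ} {L R : List ℕ} (hL : ∀ x ∈ L, c < x) (hR : ∀ x ∈ R, c < x)
    (hne : L ≠ [] ∨ R ≠ []) :
    ListAlternating (L ++ c :: R) ↔
      L.length % 2 = 1 ∧ ListAlternating L ∧ ListAlternating R := by
  have lenA : (L ++ c :: R).length = L.length + 1 + R.length := by simp; omega
  have gL : ∀ i (h : i < L.length), (L ++ c :: R)[i]'(by omega) = L[i] := fun i h =>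
    List.getElem_append_left h
  have gc : (L ++ c :: R)[L.length]'(by omega) = c := by simp
  have gR : ∀ i (h : i < R.length), (L ++ c :: R)[L.length + 1 + i]'(by omega) = R[i] := by
    intro i h
    rw [List.getElem_append_right (by omega)]
    simp [show L.length + 1 + i - L.length = i + 1 by omega]
  constructor
  · intro h
    have hodd : L.length % 2 = 1 := by
      by_cases h0 : L.length = 0
      -- With `L` empty the word would start at its minimum, against the required descent at
      -- position 0.
      · have hL0 : L = [] := List.length_eq_zero_iff.1 h0
        subst hL0
        have hRp : 0 < R.length := List.length_pos_iff.2 (by simpa using hne)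
        have h1 := (h 0 (by simpa using hRp)).2 rfl
        simp only [List.nil_append, List.getElem_cons_zero, List.getElem_cons_succ] at h1
        have := hR _ (List.getElem_mem hRp)
        omega
      · obtain ⟨q, hq⟩ : ∃ q, L.length = q + 1 := ⟨L.length - 1, by omega⟩
        have h1 := h q (by omega)
        have h2 := hL _ (List.getElem_mem (show q < L.length by omega))
        rw [gL q (by omega)] at h1
        simp only [← hq] at h1
        rw [gc] at h1
        have := h1.1 h2
        omega
    refine ⟨hodd, fun i hi => ?_, fun i hi => ?_⟩
    · have := h i (by omega)
      rwa [gL i (by omega), gL (i + 1) hi] at this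
    -- The offset `L.length + 1` is even, so parities of positions in `R` are unchanged.
    · have := h (L.length + 1 + i) (by omega)
      simp only [add_assoc (L.length + 1) i 1] at this
      rw [gR i (by omega), gR (i + 1) hi] at this
      rw [this]
      omega
  · rintro ⟨hodd, h1, h2⟩ i hi
    rcases lt_trichotomy (i + 1) L.length with h | h | h
    · rw [gL i (by omega), gL (i + 1) h]
      exact h1 i h
    · simp only [h]
      rw [gc, gL i (by omega)]
      have := hL _ (List.getElem_mem (show i < L.length by omega))
      constructor
      · intro; omega
      · intro; exact this
    · by_cases h' : i = L.length
      · subst h'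
        rw [gc]
        have e := gR 0 (by omega)
        simp only [add_zero] at e
        rw [e]
        have := hR _ (List.getElem_mem (show 0 < R.length by omega))
        omega
      · obtain ⟨q, rfl⟩ : ∃ q, i = L.length + 1 + q := ⟨i - (L.length + 1), by omega⟩
        simp only [add_assoc (L.length + 1) q 1]
        rw [gR q (by omega), gR (q + 1) (by omega), h2 q (by omega)]
        omega

/-- The alternating 312-avoiding arrangements of `c, c + 1, …, c + m - 1`. -/
def alternatingWords (c m : ℕ) : Set (List ℕ) :=
  {l | l ∈ avoidingWords c m ∧ ListAlternating l}

theorem mem_alternatingWords_add_two {c m : ℕ} {l : List ℕ} :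
    l ∈ alternatingWords c (m + 2) ↔ ∃ i ≤ m / 2, ∃ L ∈ alternatingWords (c + 1) (2 * i + 1),
      ∃ R ∈ alternatingWords (c + 1 + (2 * i + 1)) (m - 2 * i), L ++ c :: R = l := by
  have key : ∀ {k L R}, L ∈ avoidingWords (c + 1) k →
      R ∈ avoidingWords (c + 1 + k) (m + 1 - k) → (ListAlternating (L ++ c :: R) ↔
      k % 2 = 1 ∧ ListAlternating L ∧ ListAlternating R) := by
    intro k L R hL hR
    have e := length_of_mem_avoidingWords hL
    have e' := length_of_mem_avoidingWords hR
    rw [listAlternating_split (fun x hx => by have := (hL.2.1 x).1 hx; omega)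
      (fun x hx => by have := (hR.2.1 x).1 hx; omega), e]
    by_contra! h
    simp only [h.1, h.2, List.length_nil] at e e'
    omega
  constructor
  · rintro ⟨h, ha⟩
    obtain ⟨k, hk, L, hL, R, hR, rfl⟩ := mem_avoidingWords_succ.1 h
    obtain ⟨hodd, aL, aR⟩ := (key hL hR).1 ha
    obtain ⟨i, rfl⟩ : ∃ i, k = 2 * i + 1 := ⟨k / 2, by omega⟩
    rw [show m + 1 - (2 * i + 1) = m - 2 * i by omega] at hR
    exact ⟨i, by omega, L, ⟨hL, aL⟩, R, ⟨hR, aR⟩, rfl⟩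
  · rintro ⟨i, hi, L, ⟨hL, aL⟩, R, ⟨hR, aR⟩, rfl⟩
    rw [show m - 2 * i = m + 1 - (2 * i + 1) by omega] at hR
    exact ⟨mem_avoidingWords_succ.2 ⟨2 * i + 1, by omega, L, hL, R, hR, rfl⟩,
      (key hL hR).2 ⟨by omega, aL, aR⟩⟩

theorem alternatingWords_eq_of_le_one {c m : ℕ} (hm : m ≤ 1) :
    alternatingWords c m = avoidingWords c m := by
  ext l
  refine ⟨fun h => h.1, fun h => ⟨h, fun i hi => ?_⟩⟩
  rw [length_of_mem_avoidingWords h] at hi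
  omega

/-- Odd lengths must be included, because the left part always has odd length. -/
theorem encard_alternatingWords (c m : ℕ) : (alternatingWords c m).encard = catalan (m / 2) := by
  induction m using Nat.strong_induction_on generalizing c with
  | _ m ih =>
    rcases m with _ | _ | m
    · simp [alternatingWords_eq_of_le_one, encard_avoidingWords]
    · simp [alternatingWords_eq_of_le_one, encard_avoidingWords]
    · rw [encard_of_eq_biUnion_image2 (Finset.range (m / 2 + 1)) (fun _ L R => L ++ c :: R)
        (fun i => alternatingWords (c + 1) (2 * i + 1))
        (fun i => alternatingWords (c + 1 + (2 * i + 1)) (m - 2 * i))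
        (fun i => catalan i) (fun i => catalan (m / 2 - i)),
        show (m + 1 + 1) / 2 = m / 2 + 1 by omega, catalan_succ, Finset.sum_range]
      · intro i hi
        rw [Finset.mem_range] at hi
        rw [ih _ (by omega), show (2 * i + 1) / 2 = i by omega]
      · intro i hi
        rw [Finset.mem_range] at hi
        rw [ih _ (by omega), show (m - 2 * i) / 2 = m / 2 - i by omega]
      · intro l
        rw [mem_alternatingWords_add_two]
        simp
      · intro i _ i' _ L hL L' hL' R hR R' _ h
        obtain ⟨h1, h2⟩ := split_injective hL.1 hL'.1 hR.1 h
        exact ⟨by omega, h2⟩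

/-! ### Triangulations as maximal non-crossing sets of chords -/

/-- Two chords, given by the labels of their endpoints, cross. -/
def ChordsCross (d e : ℕ × ℕ) : Prop :=
  (d.1 < e.1 ∧ e.1 < d.2 ∧ d.2 < e.2) ∨ (e.1 < d.1 ∧ d.1 < e.2 ∧ e.2 < d.2)

/-- The maximal sets of pairwise non-crossing chords (sides included) of the convex polygon with
vertices `a, a + 1, …, b`. -/
def chordTriangulations (a b : ℕ) : Set (Set (ℕ × ℕ)) :=
  {S | ∀ d, d ∈ S ↔ (a ≤ d.1 ∧ d.1 < d.2 ∧ d.2 ≤ b) ∧ ∀ e ∈ S, ¬ ChordsCross d e}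

theorem mem_range_of_mem {a b i j : ℕ} {S : Set (ℕ × ℕ)} (hS : S ∈ chordTriangulations a b)
    (h : (i, j) ∈ S) : a ≤ i ∧ i < j ∧ j ≤ b :=
  ((hS _).1 h).1

theorem not_cross_of_mem {a b i j k l : ℕ} {S : Set (ℕ × ℕ)} (hS : S ∈ chordTriangulations a b)
    (h : (i, j) ∈ S) (h' : (k, l) ∈ S) : ¬ (i < k ∧ k < j ∧ j < l) := fun hc =>
  ((hS _).1 h).2 _ h' (Or.inl hc)

theorem base_mem {a b : ℕ} (hab : a < b) {S : Set (ℕ × ℕ)} (hS : S ∈ chordTriangulations a b) :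
    (a, b) ∈ S := by
  refine (hS _).2 ⟨⟨le_rfl, hab, le_rfl⟩, ?_⟩
  rintro ⟨i, j⟩ h hc
  have := mem_range_of_mem hS h
  simp only [ChordsCross] at hc
  omega

theorem first_side_mem {a b : ℕ} (hab : a < b) {S : Set (ℕ × ℕ)}
    (hS : S ∈ chordTriangulations a b) : (a, a + 1) ∈ S := by
  refine (hS _).2 ⟨⟨le_rfl, by simp, hab⟩, ?_⟩
  rintro ⟨i, j⟩ h hc
  have := mem_range_of_mem hS h
  simp only [ChordsCross] at hc
  omega

/-- Take `c < b` greatest with `(a, c) ∈ S`. A chord of `S` crossing `(c, b)` would cross `(a, c)`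
too unless it starts at `a`, and then it contradicts the choice of `c`. By maximality `(c, b)`
belongs to `S`. -/
theorem exists_apex {a b : ℕ} (hab : a + 1 < b) {S : Set (ℕ × ℕ)}
    (hS : S ∈ chordTriangulations a b) : ∃ c, a < c ∧ c < b ∧ (a, c) ∈ S ∧ (c, b) ∈ S := by
  classical
  let P : ℕ → Prop := fun c => c < b ∧ (a, c) ∈ S
  have hP1 : P (a + 1) := ⟨hab, first_side_mem (by omega) hS⟩
  have hP : P (Nat.findGreatest P b) := Nat.findGreatest_spec (m := a + 1) (by omega) hP1
  have hmax : ∀ k, P k → k ≤ Nat.findGreatest P b := fun k hk => Nat.le_findGreatest hk.1.le hk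
  generalize Nat.findGreatest P b = c at hP hmax
  have hac := mem_range_of_mem hS hP.2
  refine ⟨c, hac.2.1, hP.1, hP.2, (hS _).2 ⟨⟨hac.1.trans hac.2.1.le, hP.1, le_rfl⟩, ?_⟩⟩
  rintro ⟨i, j⟩ h hc
  have h1 := mem_range_of_mem hS h
  simp only [ChordsCross] at hc
  have h2 := not_cross_of_mem hS hP.2 h
  have h3 : i = a := by omega
  subst h3
  have := hmax j ⟨by omega, h⟩
  omega

/-- Gluing triangulations of the polygons on `a, …, c` and on `c, …, b` along a triangle. -/
def glue (a b : ℕ) (S₁ S₂ : Set (ℕ × ℕ)) : Set (ℕ × ℕ) := {(a, b)} ∪ S₁ ∪ S₂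

theorem restrict_left {a b c : ℕ} (hac : a < c) (hcb : c < b) {S₁ S₂ : Set (ℕ × ℕ)}
    (h₁ : S₁ ∈ chordTriangulations a c) (h₂ : S₂ ∈ chordTriangulations c b) :
    S₁ = {d | d ∈ glue a b S₁ S₂ ∧ d.2 ≤ c} := by
  ext ⟨i, j⟩
  simp only [glue, Set.mem_ofPred_eq, Set.mem_union, Set.mem_singleton_iff, Prod.mk.injEq]
  constructor
  · intro h
    exact ⟨Or.inl (Or.inr h), (mem_range_of_mem h₁ h).2.2⟩
  · rintro ⟨(⟨rfl, rfl⟩ | h) | h, hj⟩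
    · omega
    · exact h
    · have := mem_range_of_mem h₂ h
      omega

theorem restrict_right {a b c : ℕ} (hac : a < c) (hcb : c < b) {S₁ S₂ : Set (ℕ × ℕ)}
    (h₁ : S₁ ∈ chordTriangulations a c) (h₂ : S₂ ∈ chordTriangulations c b) :
    S₂ = {d | d ∈ glue a b S₁ S₂ ∧ c ≤ d.1} := by
  ext ⟨i, j⟩
  simp only [glue, Set.mem_ofPred_eq, Set.mem_union, Set.mem_singleton_iff, Prod.mk.injEq]
  constructor
  · intro h
    exact ⟨Or.inr h, (mem_range_of_mem h₂ h).1⟩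
  · rintro ⟨(⟨rfl, rfl⟩ | h) | h, hj⟩
    · omega
    · have := mem_range_of_mem h₁ h
      omega
    · exact h

theorem glue_mem {a b c : ℕ} (hac : a < c) (hcb : c < b) {S₁ S₂ : Set (ℕ × ℕ)}
    (h₁ : S₁ ∈ chordTriangulations a c) (h₂ : S₂ ∈ chordTriangulations c b) :
    glue a b S₁ S₂ ∈ chordTriangulations a b := by
  rintro ⟨i, j⟩
  constructor
  · rintro ((h | h) | h)
    · obtain ⟨rfl, rfl⟩ : i = a ∧ j = b := by simpa using h
      refine ⟨⟨le_rfl, by simp; omega, le_rfl⟩, ?_⟩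
      rintro ⟨k, l⟩ ((h' | h') | h') hc
      · obtain ⟨rfl, rfl⟩ : k = i ∧ l = j := by simpa using h'
        simp only [ChordsCross] at hc
        omega
      · have := mem_range_of_mem h₁ h'
        simp only [ChordsCross] at hc
        omega
      · have := mem_range_of_mem h₂ h'
        simp only [ChordsCross] at hc
        omega
    · have hr := mem_range_of_mem h₁ h
      refine ⟨⟨hr.1, hr.2.1, by simp; omega⟩, ?_⟩
      rintro ⟨k, l⟩ ((h' | h') | h') hc
      · obtain ⟨rfl, rfl⟩ : k = a ∧ l = b := by simpa using h'
        simp only [ChordsCross] at hc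
        omega
      · exact ((h₁ _).1 h).2 _ h' hc
      · have := mem_range_of_mem h₂ h'
        simp only [ChordsCross] at hc
        omega
    · have hr := mem_range_of_mem h₂ h
      refine ⟨⟨by simp; omega, hr.2.1, hr.2.2⟩, ?_⟩
      rintro ⟨k, l⟩ ((h' | h') | h') hc
      · obtain ⟨rfl, rfl⟩ : k = a ∧ l = b := by simpa using h'
        simp only [ChordsCross] at hc
        omega
      · have := mem_range_of_mem h₁ h'
        simp only [ChordsCross] at hc
        omega
      · exact ((h₂ _).1 h).2 _ h' hc
  · rintro ⟨hr, hn⟩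
    -- A chord crossing neither `(a, c)` nor `(c, b)` lies on one side of `c` or is the base `(a,
    -- b)`.
    have n1 := hn _ (Or.inl (Or.inr (base_mem hac h₁)))
    have n2 := hn _ (Or.inr (base_mem hcb h₂))
    simp only [ChordsCross] at hr n1 n2
    rcases le_or_gt j c with hj | hj
    · exact Or.inl (Or.inr ((h₁ _).2 ⟨⟨hr.1, hr.2.1, hj⟩,
        fun e he => hn e (Or.inl (Or.inr he))⟩))
    · rcases le_or_gt c i with hi | hi
      · exact Or.inr ((h₂ _).2 ⟨⟨hi, hr.2.1, hr.2.2⟩, fun e he => hn e (Or.inr he)⟩)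
      · obtain ⟨rfl, rfl⟩ : i = a ∧ j = b := by omega
        exact Or.inl (Or.inl rfl)

theorem eq_glue {a b c : ℕ} {S : Set (ℕ × ℕ)} (hS : S ∈ chordTriangulations a b)
    (hac : (a, c) ∈ S) (hcb : (c, b) ∈ S) :
    glue a b {d | d ∈ S ∧ d.2 ≤ c} {d | d ∈ S ∧ c ≤ d.1} = S := by
  have r1 := mem_range_of_mem hS hac
  have r2 := mem_range_of_mem hS hcb
  ext ⟨i, j⟩
  simp only [glue, Set.mem_ofPred_eq, Set.mem_union, Set.mem_singleton_iff, Prod.mk.injEq]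
  constructor
  · rintro ((⟨rfl, rfl⟩ | h) | h)
    · exact base_mem (by omega) hS
    · exact h.1
    · exact h.1
  · intro h
    have := mem_range_of_mem hS h
    have n1 := not_cross_of_mem hS hac h
    have n2 := not_cross_of_mem hS h hcb
    by_cases hj : j ≤ c
    · exact Or.inl (Or.inr ⟨h, hj⟩)
    · by_cases hi : c ≤ i
      · exact Or.inr ⟨h, hi⟩
      · exact Or.inl (Or.inl (by omega))

theorem left_mem {a b c : ℕ} {S : Set (ℕ × ℕ)} (hS : S ∈ chordTriangulations a b)
    (hac : (a, c) ∈ S) (hcb : (c, b) ∈ S) :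
    {d | d ∈ S ∧ d.2 ≤ c} ∈ chordTriangulations a c := by
  have r1 := mem_range_of_mem hS hac
  have r2 := mem_range_of_mem hS hcb
  rintro ⟨i, j⟩
  constructor
  · rintro ⟨h, hj⟩
    have hr := mem_range_of_mem hS h
    exact ⟨⟨hr.1, hr.2.1, hj⟩, fun e he => ((hS _).1 h).2 e he.1⟩
  · rintro ⟨hr, hn⟩
    refine ⟨(hS _).2 ⟨⟨hr.1, hr.2.1, by omega⟩, ?_⟩, hr.2.2⟩
    rintro ⟨k, l⟩ he hc
    by_cases hl : l ≤ c
    · exact hn _ ⟨he, hl⟩ hc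
    · have h1 := mem_range_of_mem hS he
      have n1 := not_cross_of_mem hS hac he
      simp only [ChordsCross] at hc hr
      omega

theorem right_mem {a b c : ℕ} {S : Set (ℕ × ℕ)} (hS : S ∈ chordTriangulations a b)
    (hac : (a, c) ∈ S) (hcb : (c, b) ∈ S) :
    {d | d ∈ S ∧ c ≤ d.1} ∈ chordTriangulations c b := by
  have r1 := mem_range_of_mem hS hac
  have r2 := mem_range_of_mem hS hcb
  rintro ⟨i, j⟩
  constructor
  · rintro ⟨h, hj⟩
    have hr := mem_range_of_mem hS h
    exact ⟨⟨hj, hr.2.1, hr.2.2⟩, fun e he => ((hS _).1 h).2 e he.1⟩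
  · rintro ⟨hr, hn⟩
    refine ⟨(hS _).2 ⟨⟨by omega, hr.2.1, hr.2.2⟩, ?_⟩, hr.1⟩
    rintro ⟨k, l⟩ he hc
    by_cases hl : c ≤ k
    · exact hn _ ⟨he, hl⟩ hc
    · have h1 := mem_range_of_mem hS he
      have n1 := not_cross_of_mem hS he hcb
      simp only [ChordsCross] at hc hr
      omega

theorem chordTriangulations_edge (a : ℕ) : chordTriangulations a (a + 1) = {{(a, a + 1)}} := by
  have key : ∀ i j, a ≤ i ∧ i < j ∧ j ≤ a + 1 ↔ (i, j) = (a, a + 1) := by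
    intro i j
    rw [Prod.mk.injEq]
    omega
  ext S
  rw [Set.mem_singleton_iff]
  constructor
  · intro hS
    ext ⟨i, j⟩
    rw [Set.mem_singleton_iff, ← key]
    refine ⟨mem_range_of_mem hS, fun h => ?_⟩
    rw [(key i j).1 h]
    exact base_mem (by omega) hS
  · rintro rfl ⟨i, j⟩
    rw [Set.mem_singleton_iff, key]
    refine ⟨fun h => ⟨h, ?_⟩, fun h => h.1⟩
    rintro e rfl hc
    rw [h] at hc
    simp only [ChordsCross] at hc
    omega

theorem encard_chordTriangulations (a n : ℕ) :
    (chordTriangulations a (a + 1 + n)).encard = catalan n := by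
  induction n using Nat.strong_induction_on generalizing a with
  | _ n ih =>
    rcases n with _ | n
    · simp [chordTriangulations_edge]
    · rw [encard_of_eq_biUnion_image2 (Finset.range (n + 1))
        (fun _ S₁ S₂ => glue a (a + 1 + (n + 1)) S₁ S₂)
        (fun k => chordTriangulations a (a + 1 + k))
        (fun k => chordTriangulations (a + 1 + k) (a + 1 + (n + 1)))
        (fun k => catalan k) (fun k => catalan (n - k)), catalan_succ, Finset.sum_range]
      · intro k hk
        exact ih k (by simpa using hk) _
      · intro k hk
        rw [Finset.mem_range] at hk
        rw [← ih _ (by omega) (a + 1 + k),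
          show a + 1 + k + 1 + (n - k) = a + 1 + (n + 1) by omega]
      · intro S
        constructor
        · intro hS
          obtain ⟨c, hac, hcb, h1, h2⟩ := exists_apex (by omega) hS
          obtain ⟨k, rfl⟩ : ∃ k, c = a + 1 + k := ⟨c - (a + 1), by omega⟩
          exact ⟨k, by simp; omega, _, left_mem hS h1 h2, _, right_mem hS h1 h2, eq_glue hS h1 h2⟩
        · rintro ⟨k, hk, S₁, h₁, S₂, h₂, rfl⟩
          rw [Finset.mem_range] at hk
          exact glue_mem (by omega) (by omega) h₁ h₂
      · intro k hk k' hk' S₁ h₁ S₁' h₁' S₂ h₂ S₂' h₂' e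
        rw [Finset.mem_range] at hk hk'
        have hG := glue_mem (by omega) (by omega) h₁ h₂
        have m1 : (a, a + 1 + k) ∈ glue a (a + 1 + (n + 1)) S₁ S₂ :=
          Or.inl (Or.inr (base_mem (by omega) h₁))
        have m2 : (a + 1 + k, a + 1 + (n + 1)) ∈ glue a (a + 1 + (n + 1)) S₁ S₂ :=
          Or.inr (base_mem (by omega) h₂)
        have m1' : (a, a + 1 + k') ∈ glue a (a + 1 + (n + 1)) S₁ S₂ :=
          e ▸ Or.inl (Or.inr (base_mem (by omega) h₁'))
        have m2' : (a + 1 + k', a + 1 + (n + 1)) ∈ glue a (a + 1 + (n + 1)) S₁ S₂ :=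
          e ▸ Or.inr (base_mem (by omega) h₂')
        -- The apex is unique: with two apexes, the chord from `a` to the larger crosses the chord
        -- from the smaller to the other end of the base.
        have n1 := not_cross_of_mem hG m1 m2'
        have n2 := not_cross_of_mem hG m1' m2
        obtain rfl : k = k' := by omega
        refine ⟨rfl, ?_, ?_⟩
        · rw [restrict_left (by omega) (by omega) h₁ h₂, e,
            ← restrict_left (by omega) (by omega) h₁' h₂']
        · rw [restrict_right (by omega) (by omega) h₁ h₂, e,
            ← restrict_right (by omega) (by omega) h₁' h₂']

/-! ### From permutations to words -/

/-- The one-line notation of a permutation, as a word over `ℕ`. -/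
def word {m : ℕ} (π : Equiv.Perm (Fin m)) : List ℕ := List.ofFn fun i => (π i : ℕ)

theorem length_word {m : ℕ} (π : Equiv.Perm (Fin m)) : (word π).length = m := by simp [word]

theorem getElem_word {m : ℕ} (π : Equiv.Perm (Fin m)) (i : ℕ) (h : i < (word π).length) :
    (word π)[i] = π ⟨i, length_word π ▸ h⟩ := by simp [word]

theorem word_injective {m : ℕ} : Function.Injective (word (m := m)) := by
  intro π σ h
  ext i
  exact congrFun (List.ofFn_injective h) i

theorem nodup_word {m : ℕ} (π : Equiv.Perm (Fin m)) : (word π).Nodup :=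
  List.nodup_ofFn.2 (Fin.val_injective.comp π.injective)

theorem mem_word {m : ℕ} (π : Equiv.Perm (Fin m)) (x : ℕ) : x ∈ word π ↔ 0 ≤ x ∧ x < 0 + m := by
  simp only [word, List.mem_ofFn, zero_le, true_and, zero_add]
  constructor
  · rintro ⟨i, rfl⟩
    exact (π i).2
  · intro h
    exact ⟨π.symm ⟨x, h⟩, by simp⟩

theorem exists_word_eq {m : ℕ} {l : List ℕ} (hn : l.Nodup)
    (hm : ∀ x, x ∈ l ↔ 0 ≤ x ∧ x < 0 + m) (hl : l.length = m) :
    ∃ π : Equiv.Perm (Fin m), word π = l := by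
  let f : Fin m → Fin m := fun i =>
    ⟨l[i.val]'(by omega), by have := (hm _).1 (List.getElem_mem (show i.val < l.length by omega)); omega⟩
  have hf : Function.Injective f := by
    intro i j h
    have h' : l[i.val]'(by omega) = l[j.val]'(by omega) := congrArg Fin.val h
    exact Fin.ext ((List.Nodup.getElem_inj_iff hn).1 h')
  refine ⟨Equiv.ofBijective f (Finite.injective_iff_bijective.1 hf), ?_⟩
  refine List.ext_getElem (by rw [length_word, hl]) fun i h1 h2 => ?_
  rw [getElem_word]
  rfl

theorem listAvoids_word {m : ℕ} (π : Equiv.Perm (Fin m)) :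
    ListAvoids (word π) ↔ Avoids312 π := by
  constructor
  · rintro h i j k hij hjk ⟨h1, h2⟩
    refine h (π i) (π j) (π k) ?_ ⟨h1, h2⟩
    -- Increasing positions form a sublist of the sorted list of all positions; mapping by `π` gives
    -- a subword.
    have hp : ([i, j, k] : List (Fin m)).Sublist (List.finRange m) := by
      refine List.sublist_of_subperm_of_pairwise (r := (· < ·)) ?_ ?_ ?_
      · refine List.Nodup.subperm ?_ fun x _ => List.mem_finRange x
        simp [hij.ne, hjk.ne, (hij.trans hjk).ne]
      · simp [hij, hjk, hij.trans hjk]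
      · exact List.pairwise_lt_finRange m
    have := hp.map fun i => (π i : ℕ)
    rwa [← List.ofFn_eq_map] at this
  · rintro h x y z hs ⟨h1, h2⟩
    rw [word, List.ofFn_eq_map] at hs
    obtain ⟨l, hl, he⟩ := List.sublist_map_iff.1 hs
    obtain ⟨i, t, rfl, rfl, h3⟩ := List.map_eq_cons_iff.1 he.symm
    obtain ⟨j, t, rfl, rfl, h4⟩ := List.map_eq_cons_iff.1 h3
    obtain ⟨k, t, rfl, rfl, -⟩ := List.map_eq_cons_iff.1 h4
    have hp := (List.pairwise_lt_finRange m).sublist hl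
    simp only [List.pairwise_cons, List.mem_cons] at hp
    exact h i j k (hp.1 j (by simp)) (hp.2.1 k (by simp)) ⟨h1, h2⟩

theorem listAlternating_word {m : ℕ} (π : Equiv.Perm (Fin m)) :
    ListAlternating (word π) ↔ IsAlternating π := by
  have key : ∀ P Q : Prop, ∀ [Decidable P] [Decidable Q],
      (if P then UpDown.D else UpDown.U) = (if Q then UpDown.D else UpDown.U) ↔ (P ↔ Q) := by
    intro P Q _ _
    by_cases hP : P <;> by_cases hQ : Q <;> simp [hP, hQ]
  simp only [IsAlternating, funext_iff, upDownPattern, alternatingWord, key, ListAlternating,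
    getElem_word, length_word, Fin.lt_def]
  exact ⟨fun h i => h i (by omega), fun h i hi => h ⟨i, by omega⟩⟩

theorem encard_avoids312 (m : ℕ) :
    {π : Equiv.Perm (Fin m) | Avoids312 π}.encard = catalan m := by
  rw [← word_injective.encard_image, ← encard_avoidingWords 0 m]
  congr 1
  ext l
  constructor
  · rintro ⟨π, hπ, rfl⟩
    exact ⟨nodup_word π, mem_word π, (listAvoids_word π).2 hπ⟩
  · intro h
    obtain ⟨π, rfl⟩ := exists_word_eq h.1 h.2.1 (length_of_mem_avoidingWords h)
    exact ⟨π, (listAvoids_word π).1 h.2.2, rfl⟩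

theorem encard_alternating (m : ℕ) :
    {π : Equiv.Perm (Fin m) | IsAlternating π ∧ Avoids312 π}.encard = catalan (m / 2) := by
  rw [← word_injective.encard_image, ← encard_alternatingWords 0 m]
  congr 1
  ext l
  constructor
  · rintro ⟨π, hπ, rfl⟩
    exact ⟨⟨nodup_word π, mem_word π, (listAvoids_word π).2 hπ.2⟩, (listAlternating_word π).2 hπ.1⟩
  · rintro ⟨h, ha⟩
    obtain ⟨π, rfl⟩ := exists_word_eq h.1 h.2.1 (length_of_mem_avoidingWords h)
    exact ⟨π, ⟨(listAlternating_word π).1 ha, (listAvoids_word π).1 h.2.2⟩, rfl⟩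

/-! ### From sets of diagonals to sets of chords -/

theorem crosses_comm {m : ℕ} {d e : Fin m × Fin m} : Crosses d e ↔ Crosses e d := or_comm

theorem not_crosses_self {m : ℕ} (d : Fin m × Fin m) : ¬ Crosses d d := by
  simp [Crosses]

/-- Maximality as a fixed-point condition, matching `chordTriangulations`: a diagonal crossing
nothing in `T` could be inserted. -/
theorem isTriangulation_iff {m : ℕ} {T : Finset (Fin m × Fin m)} :
    IsTriangulation T ↔ ∀ d, d ∈ T ↔ IsDiagonal d ∧ ∀ e ∈ T, ¬ Crosses d e := by
  constructor
  · intro h d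
    refine ⟨fun hd => ⟨h.1.1 d hd, h.1.2 d hd⟩, fun hd => ?_⟩
    have hI : IsDissection (insert d T) := by
      constructor
      · intro e he
        rcases Finset.mem_insert.1 he with rfl | he
        · exact hd.1
        · exact h.1.1 e he
      · intro e he f hf
        rcases Finset.mem_insert.1 he with rfl | he'
        · rcases Finset.mem_insert.1 hf with rfl | hf'
          · exact not_crosses_self _
          · exact hd.2 f hf'
        · rcases Finset.mem_insert.1 hf with rfl | hf'
          · rw [crosses_comm]
            exact hd.2 e he'
          · exact h.1.2 e he' f hf'
    exact h.2 hI (Finset.subset_insert d T) (Finset.mem_insert_self d T)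
  · intro h
    refine ⟨⟨fun d hd => ((h d).1 hd).1, fun d hd => ((h d).1 hd).2⟩, fun T' hT' hle d hd => ?_⟩
    exact (h d).2 ⟨hT'.1 d hd, fun e he => hT'.2 d hd e (hle he)⟩

/-- The diagonals of a dissection of the `(n + 2)`-gon together with the sides of the polygon. -/
def chords {n : ℕ} (T : Finset (Fin (n + 2) × Fin (n + 2))) : Set (ℕ × ℕ) :=
  {d | ((d.1 < d.2 ∧ d.2 ≤ n + 1) ∧ (d.2 = d.1 + 1 ∨ d.1 = 0 ∧ d.2 = n + 1)) ∨
    ∃ e ∈ T, ((e.1 : ℕ), (e.2 : ℕ)) = d}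

theorem mem_iff_mem_chords {n : ℕ} {T : Finset (Fin (n + 2) × Fin (n + 2))}
    (hT : ∀ d ∈ T, IsDiagonal d) (d : Fin (n + 2) × Fin (n + 2)) :
    d ∈ T ↔ IsDiagonal d ∧ ((d.1 : ℕ), (d.2 : ℕ)) ∈ chords T := by
  constructor
  · exact fun h => ⟨hT d h, Or.inr ⟨d, h, rfl⟩⟩
  · rintro ⟨h, h' | ⟨e, he, h'⟩⟩
    · simp only [IsDiagonal] at h h'
      omega
    · rw [Prod.mk.injEq, ← Fin.ext_iff, ← Fin.ext_iff] at h'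
      rwa [← Prod.ext h'.1 h'.2]

/-- Sides cross no chord of the polygon, so adding them preserves both non-crossing and maximality.
-/
theorem chords_mem {n : ℕ} {T : Finset (Fin (n + 2) × Fin (n + 2))} (hT : IsTriangulation T) :
    chords T ∈ chordTriangulations 0 (n + 1) := by
  rw [isTriangulation_iff] at hT
  rintro ⟨i, j⟩
  constructor
  · rintro (⟨⟨h1, h2⟩, h3⟩ | ⟨⟨d₁, d₂⟩, hd, h⟩)
    · refine ⟨⟨Nat.zero_le _, h1, h2⟩, ?_⟩
      rintro ⟨k, l⟩ (⟨⟨h1', h2'⟩, h3'⟩ | ⟨⟨e₁, e₂⟩, he, h'⟩) hc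
      · simp only [ChordsCross] at *
        omega
      · simp only [Prod.mk.injEq, ChordsCross] at *
        omega
    · obtain ⟨rfl, rfl⟩ := Prod.mk.inj h
      have hdd := (hT _).1 hd
      have hdi := hdd.1
      simp only [IsDiagonal] at hdi
      refine ⟨⟨Nat.zero_le _, by simp only; omega, by simp only; omega⟩, ?_⟩
      rintro ⟨k, l⟩ (⟨⟨h1', h2'⟩, h3'⟩ | ⟨⟨e₁, e₂⟩, he, h'⟩) hc
      · simp only [ChordsCross] at *
        omega
      · obtain ⟨rfl, rfl⟩ := Prod.mk.inj h'
        exact hdd.2 _ he hc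
  · rintro ⟨⟨-, h1, h2⟩, h⟩
    by_cases hs : j = i + 1 ∨ i = 0 ∧ j = n + 1
    · exact Or.inl ⟨⟨h1, h2⟩, hs⟩
    · simp only at h1 h2
      refine Or.inr ⟨(⟨i, by omega⟩, ⟨j, by omega⟩), (hT _).2 ⟨?_, fun e he hc => ?_⟩, rfl⟩
      · simp only [IsDiagonal]
        omega
      · exact h (e.1, e.2) (Or.inr ⟨e, he, rfl⟩) hc

theorem exists_chords_eq {n : ℕ} {S : Set (ℕ × ℕ)} (hS : S ∈ chordTriangulations 0 (n + 1)) :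
    ∃ T : Finset (Fin (n + 2) × Fin (n + 2)), IsTriangulation T ∧ chords T = S := by
  classical
  let T : Finset (Fin (n + 2) × Fin (n + 2)) :=
    Finset.univ.filter fun d => IsDiagonal d ∧ ((d.1 : ℕ), (d.2 : ℕ)) ∈ S
  have hT : ∀ d, d ∈ T ↔ IsDiagonal d ∧ ((d.1 : ℕ), (d.2 : ℕ)) ∈ S := by simp [T]
  have hc : chords T = S := by
    ext ⟨i, j⟩
    constructor
    · rintro (⟨⟨h1, h2⟩, h3⟩ | ⟨d, hd, h⟩)
      · refine (hS _).2 ⟨⟨Nat.zero_le _, h1, h2⟩, ?_⟩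
        rintro ⟨k, l⟩ he hc
        have := mem_range_of_mem hS he
        simp only [ChordsCross] at *
        omega
      · rw [← h]
        exact ((hT d).1 hd).2
    · intro h
      have hr := mem_range_of_mem hS h
      by_cases hs : j = i + 1 ∨ i = 0 ∧ j = n + 1
      · exact Or.inl ⟨hr.2, hs⟩
      · refine Or.inr ⟨(⟨i, by omega⟩, ⟨j, by omega⟩), (hT _).2 ⟨?_, h⟩, rfl⟩
        simp only [IsDiagonal]
        omega
  refine ⟨T, isTriangulation_iff.2 fun d => ?_, hc⟩
  rw [hT]
  refine and_congr_right fun hd => ⟨fun h e he => ((hS _).1 h).2 _ ((hT e).1 he).2, fun h => ?_⟩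
  have hdd := hd
  simp only [IsDiagonal] at hdd
  refine (hS _).2 ⟨⟨Nat.zero_le _, by simp only; omega, by simp only; omega⟩, ?_⟩
  rw [← hc]
  rintro ⟨k, l⟩ (⟨⟨h1, h2⟩, h3⟩ | ⟨e, he, h'⟩) hx
  · simp only [ChordsCross] at *
    omega
  · obtain ⟨rfl, rfl⟩ := Prod.mk.inj h'
    exact h e he hx

theorem encard_triangulations (n : ℕ) :
    {T : Finset (Fin (n + 2) × Fin (n + 2)) | IsTriangulation T}.encard = catalan n := by
  have hinj : Set.InjOn (chords (n := n)) {T | IsTriangulation T} := by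
    intro T hT T' hT' h
    ext d
    rw [mem_iff_mem_chords (Maximal.prop hT).1, h, ← mem_iff_mem_chords (Maximal.prop hT').1]
  rw [← hinj.encard_image, ← encard_chordTriangulations 0 n]
  congr 1
  ext S
  constructor
  · rintro ⟨T, hT, rfl⟩
    have := chords_mem hT
    rwa [add_comm n 1, ← zero_add 1] at this
  · intro hS
    rw [show 0 + 1 + n = n + 1 by omega] at hS
    exact exists_chords_eq hS

theorem nonempty_equiv_of_encard_eq {α β : Type*} {s : Set α} {t : Set β} {k : ℕ}
    (hs : s.encard = k) (ht : t.encard = k) : Nonempty (s ≃ t) := by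
  have := (Set.finite_of_encard_eq_coe hs).to_subtype
  have := (Set.finite_of_encard_eq_coe ht).to_subtype
  refine ⟨(Finite.equivFinOfCardEq ?_).trans (Finite.equivFinOfCardEq (n := k) ?_).symm⟩ <;>
    simp [Nat.card_coe_set_eq, Set.ncard, hs, ht]

end PermPolygon

theorem corollary1 (n : ℕ) :
    Nonempty ({π : Equiv.Perm (Fin (2 * n)) //
          PermPolygon.IsAlternating π ∧ PermPolygon.Avoids312 π} ≃
        {T : Finset (Fin (n + 2) × Fin (n + 2)) // PermPolygon.IsTriangulation T}) ∧
      Nonempty ({π : Equiv.Perm (Fin (2 * n)) //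
          PermPolygon.IsAlternating π ∧ PermPolygon.Avoids312 π} ≃
        {σ : Equiv.Perm (Fin n) // PermPolygon.Avoids312 σ}) := by
  have h := PermPolygon.encard_alternating (2 * n)
  rw [Nat.mul_div_cancel_left n two_pos] at h
  exact ⟨PermPolygon.nonempty_equiv_of_encard_eq h (PermPolygon.encard_triangulations n),
    PermPolygon.nonempty_equiv_of_encard_eq h (PermPolygon.encard_avoids312 n)⟩
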